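/- An \emph{MT-algebra} is a complete boolean algebra $M$ with an interior operator $\square$ ($\square 1=1$, $\square(a\wedge b)=\square a\wedge\square b$, $\square a\le a$, $\square a\le\square\square a$). Its \emph{open} elements are the fixpoints of $\square$, its \emph{closed} elements are the fixpoints of $\neg\square\neg$, and its \emph{saturated} elements are the meets of open elements; write $\mathcal O M$ and $\mathcal S M$ for the sets of open and of saturated elements, and $\mathscr B\mathcal S M$ for the boolean subalgebra of $M$ generated by $\mathcal S M$. $M$ is a \emph{$T_0$-algebra} if each element is a join of elements $s\wedge c$ with $s$ saturated and $c$ closed. A \emph{Raney morphism} $f:M\to M'$ of MT-algebras is a map that restricts to a coframe morphism $\mathcal S M\to\mathcal S M'$ and to a frame morphism $\mathcal O M\to\mathcal O M'$, preserves binary meets, satisfies $f(x\vee y)=f(x)\vee f(y)$ for $x,y\in\mathscr B\mathcal S M$, and satisfies $f(a)=\bigvee\{f(x)\mid x\in\mathscr B\mathcal S M,\ x\le a\}$ for all $a\in M$. Let $\mathbf{RMT}$ be the category of MT-algebras and Raney morphisms, with composition $(g\star f)(a)=\bigvee\{g(f(x))\mid x\in\mathscr B\mathcal S M,\ x\le a\}$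 and identities $id_M(a)=\bigvee\{x\in\mathscr B\mathcal S M\mid x\le a\}$, and let $\mathbf{T_0RMT}$ be its full subcategory of $T_0$-algebras. A \emph{Raney extension} is a pair $(C,L)$, where $C$ is a coframe and $L\subseteq C$ is a subframe (closed under the arbitrary joins and finite meets of $C$, and a frame) such that every element of $C$ is a meet of elements of $L$ and $a\wedge\bigvee S=\bigvee\{a\wedge s\mid s\in S\}$ for all $a\in C$, $S\subseteq L$. A morphism $(C,L)\to(C',L')$ is a coframe morphism $C\to C'$ that restricts to a frame morphism $L\to L'$. Let $\mathbf{Raney}$ be the resulting category. Let $\mathsf R:\mathbf{RMT}\to\mathbf{Raney}$ be the functor $M\mapsto(\mathcal S M,\mathcal O M)$, $f\mapsto f|_{\mathcal S M}$. Let $\mathscr F:\mathbf{Raney}\to\mathbf{RMT}$ be the functor sending $R=(C,L)$ to its \emph{Funayama envelope}, i.e. the MacNeille completion of the boolean envelope $\mathscr B C$ of $C$ with $\square a=\bigvee\{u\in L\mid u\le a\}$, and sending $h:C_1\to C_2$ to $\mathscr F h(a)=\bigvee\{\mathscr B h(x)\mid x\in\mathscr B C_1,\ x\le a\}$, where $\mathscr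 B h:\mathscr B C_1\to\mathscr B C_2$ is the boolean morphism extending $h$. \textbf{Theorem.} (1) There is an adjunction $\mathscr F\dashv\mathsf R$ whose unit $\rho_R:R\to\mathsf R\mathscr F R$ is the canonical embedding of $C$ into $\mathscr F R$ and whose unit $\rho$ and counit $\zeta:\mathscr F\mathsf R\to 1_{\mathbf{RMT}}$ are isomorphisms; thus $\mathsf R$ and $\mathscr F$ form an equivalence between $\mathbf{RMT}$ and $\mathbf{Raney}$. (2) Every $\mathscr F R$ is a $T_0$-algebra, and the equivalence restricts, with the same unit and counit, to an equivalence between $\mathbf{T_0RMT}$ and $\mathbf{Raney}$. (3) Consequently, $\mathscr F\mathsf R:\mathbf{RMT}\to\mathbf{T_0RMT}$ is a reflector, i.e. left adjoint to the inclusion, with unit inverse to $\zeta$, and it is an equivalence of categories. (4) $\mathscr F R$ is the $T_0$-hull of the Raney extension $R$: it is a $T_0$-algebra with $\mathsf R\mathscr F R\cong R$ via $\rho_R$, and for every $T_0$-algebra $M$ and every isomorphism $i:\mathsf R M\to R$ in $\mathbf{Raney}$ there is a unique order-isomorphism $e:M\to\mathscr F R$ that commutes with $\square$ and satisfies $e(s)=\rho_R(i(s))$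 for all $s\in\mathcal S M$. -/

import Mathlib

open CategoryTheory

universe u

/-- A McKinsey-Tarski algebra: a complete boolean algebra with an interior operator. -/
structure MTAlg : Type (u + 1) where
  carrier : Type u
  [str : CompleteBooleanAlgebra carrier]
  box : carrier → carrier
  box_top : box ⊤ = ⊤
  box_inf : ∀ a b, box (a ⊓ b) = box a ⊓ box b
  box_le : ∀ a, box a ≤ a
  le_box_box : ∀ a, box a ≤ box (box a)

namespace MTAlg

instance : CoeSort MTAlg.{u} (Type u) := ⟨MTAlg.carrier⟩

instance (M : MTAlg.{u}) : CompleteBooleanAlgebra M := M.str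

/-- The open elements. -/
def opens (M : MTAlg.{u}) : Set M := {a | M.box a = a}

/-- The closed elements: the fixpoints of the closure operator `¬ □ ¬`. -/
def closeds (M : MTAlg.{u}) : Set M := {a | (M.box aᶜ)ᶜ = a}

/-- The saturated elements: the meets of open elements. -/
def sats (M : MTAlg.{u}) : Set M := {a | ∃ S ⊆ M.opens, a = sInf S}

/-- The boolean subalgebra generated by the saturated elements. -/
def BS (M : MTAlg.{u}) : BooleanSubalgebra M := BooleanSubalgebra.closure M.sats

variable (M : MTAlg.{u})

theorem box_mono {a b : M} (h : a ≤ b) : M.box a ≤ M.box b := by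
  have := M.box_inf a b
  rw [inf_eq_left.2 h] at this
  exact inf_eq_left.1 this.symm

theorem top_mem_opens : (⊤ : M) ∈ M.opens := M.box_top

theorem inf_mem_opens {a b : M} (ha : a ∈ M.opens) (hb : b ∈ M.opens) :
    a ⊓ b ∈ M.opens := by
  change M.box _ = _
  rw [M.box_inf, show M.box a = a from ha, show M.box b = b from hb]

theorem sSup_mem_opens {S : Set M} (hS : S ⊆ M.opens) : sSup S ∈ M.opens := by
  refine le_antisymm (M.box_le _) (sSup_le fun a ha => ?_)
  rw [← show M.box a = a from hS ha]
  exact M.box_mono (le_sSup ha)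

theorem sup_mem_opens {a b : M} (ha : a ∈ M.opens) (hb : b ∈ M.opens) :
    a ⊔ b ∈ M.opens := by
  rw [← sSup_pair]
  exact M.sSup_mem_opens (by rintro x (rfl | rfl) <;> assumption)

theorem opens_subset_sats : M.opens ⊆ M.sats := fun a ha =>
  ⟨{a}, by simpa using ha, by simp⟩

theorem mem_sats_iff {a : M} : a ∈ M.sats ↔ ∀ b : M, (∀ u ∈ M.opens, a ≤ u → b ≤ u) → b ≤ a := by
  constructor
  · rintro ⟨S, hS, rfl⟩ b hb
    exact le_sInf fun u hu => hb u (hS hu) (sInf_le hu)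
  · intro h
    refine ⟨{u | u ∈ M.opens ∧ a ≤ u}, fun u hu => hu.1, le_antisymm (le_sInf fun u hu => hu.2) ?_⟩
    exact h _ fun u hu hau => sInf_le ⟨hu, hau⟩

theorem sInf_mem_sats {S : Set M} (hS : S ⊆ M.sats) : sInf S ∈ M.sats := by
  rw [mem_sats_iff]
  intro b hb
  refine le_sInf fun s hs => (M.mem_sats_iff.1 (hS hs)) b fun u hu hsu => ?_
  exact hb u hu ((sInf_le hs).trans hsu)

theorem top_mem_sats : (⊤ : M) ∈ M.sats := M.opens_subset_sats M.top_mem_opens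

theorem bot_mem_sats : (⊥ : M) ∈ M.sats := by
  have := M.sSup_mem_opens (S := ∅) (by simp)
  rw [sSup_empty] at this
  exact M.opens_subset_sats this

theorem inf_mem_sats {a b : M} (ha : a ∈ M.sats) (hb : b ∈ M.sats) : a ⊓ b ∈ M.sats := by
  rw [← sInf_pair]
  exact M.sInf_mem_sats (by rintro x (rfl | rfl) <;> assumption)

theorem sup_mem_sats {a b : M} (ha : a ∈ M.sats) (hb : b ∈ M.sats) : a ⊔ b ∈ M.sats := by
  obtain ⟨S, hS, rfl⟩ := ha
  obtain ⟨T, hT, rfl⟩ := hb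
  refine ⟨(fun p : M × M => p.1 ⊔ p.2) '' (S ×ˢ T), ?_, ?_⟩
  · rintro _ ⟨⟨s, t⟩, ⟨hs, ht⟩, rfl⟩
    exact M.sup_mem_opens (hS hs) (hT ht)
  · rw [sInf_sup_sInf, sInf_image]

theorem sats_subset_BS : M.sats ⊆ M.BS := BooleanSubalgebra.subset_closure

theorem opens_subset_BS : M.opens ⊆ M.BS := M.opens_subset_sats.trans M.sats_subset_BS

end MTAlg

/-- A Raney morphism between MT-algebras. Saturated elements are closed under arbitrary meets and
finite joins of `M`, and open elements under arbitrary joins and finite meets of `M`, so these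
meets and joins may be computed in `M`. -/
@[ext]
structure RaneyMor (M N : MTAlg.{u}) where
  toFun : M → N
  map_mem_sats : ∀ s ∈ M.sats, toFun s ∈ N.sats
  map_sInf_sats : ∀ S ⊆ M.sats, toFun (sInf S) = sInf (toFun '' S)
  map_sup_sats : ∀ s ∈ M.sats, ∀ t ∈ M.sats, toFun (s ⊔ t) = toFun s ⊔ toFun t
  map_bot : toFun ⊥ = ⊥
  map_mem_opens : ∀ u ∈ M.opens, toFun u ∈ N.opens
  map_sSup_opens : ∀ S ⊆ M.opens, toFun (sSup S) = sSup (toFun '' S)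
  map_inf_opens : ∀ u ∈ M.opens, ∀ v ∈ M.opens, toFun (u ⊓ v) = toFun u ⊓ toFun v
  map_top : toFun ⊤ = ⊤
  map_inf : ∀ a b, toFun (a ⊓ b) = toFun a ⊓ toFun b
  map_sup : ∀ x ∈ M.BS, ∀ y ∈ M.BS, toFun (x ⊔ y) = toFun x ⊔ toFun y
  map_eq_sSup : ∀ a, toFun a = sSup (toFun '' {x | x ∈ M.BS ∧ x ≤ a})

namespace RaneyMor

variable {M N P Q : MTAlg.{u}}

instance : CoeFun (RaneyMor M N) (fun _ => M → N) := ⟨RaneyMor.toFun⟩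

theorem mono (f : RaneyMor M N) : Monotone f := fun a b h => by
  have := f.map_inf a b
  rw [inf_eq_left.2 h] at this
  exact inf_eq_left.1 this.symm

theorem map_compl (f : RaneyMor M N) {x : M} (hx : x ∈ M.BS) : f xᶜ = (f x)ᶜ := by
  refine (IsCompl.compl_eq (IsCompl.of_eq ?_ ?_)).symm
  · rw [← f.map_inf, inf_compl_self, f.map_bot]
  · rw [← f.map_sup _ hx _ (M.BS.compl_mem hx), sup_compl_eq_top, f.map_top]

theorem map_mem_BS (f : RaneyMor M N) {x : M} (hx : x ∈ M.BS) : f x ∈ N.BS := by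
  unfold MTAlg.BS at hx
  induction hx using BooleanSubalgebra.closure_bot_sup_induction with
  | mem x hx => exact N.sats_subset_BS (f.map_mem_sats x hx)
  | bot => rw [f.map_bot]; exact BooleanSubalgebra.bot_mem
  | sup x hx y hy ihx ihy => rw [f.map_sup x hx y hy]; exact BooleanSubalgebra.sup_mem ihx ihy
  | compl x hx ih => rw [f.map_compl hx]; exact BooleanSubalgebra.compl_mem ih

/-- The map `a ↦ ⋁ {g x | x ∈ BS M, x ≤ a}`. -/
def joinExt (g : M → N) (a : M) : N := sSup (g '' {x | x ∈ M.BS ∧ x ≤ a})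

theorem joinExt_of_mem {g : M → N} (hg : MonotoneOn g M.BS) {x : M} (hx : x ∈ M.BS) :
    joinExt g x = g x := by
  refine le_antisymm (sSup_le ?_) (le_sSup ⟨x, ⟨hx, le_rfl⟩, rfl⟩)
  rintro _ ⟨y, ⟨hy, hyx⟩, rfl⟩
  exact hg hy hx hyx

/-- A map that behaves well on `BS M` extends to a Raney morphism by joins from below. -/
def ofBS (g : M → N) (map_mem_sats : ∀ s ∈ M.sats, g s ∈ N.sats)
    (map_sInf : ∀ S ⊆ M.sats, g (sInf S) = sInf (g '' S)) (map_bot : g ⊥ = ⊥)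
    (map_mem_opens : ∀ u ∈ M.opens, g u ∈ N.opens)
    (map_sSup : ∀ S ⊆ M.opens, g (sSup S) = sSup (g '' S)) (map_top : g ⊤ = ⊤)
    (map_inf : ∀ x ∈ M.BS, ∀ y ∈ M.BS, g (x ⊓ y) = g x ⊓ g y)
    (map_sup : ∀ x ∈ M.BS, ∀ y ∈ M.BS, g (x ⊔ y) = g x ⊔ g y) : RaneyMor M N :=
  have mono : MonotoneOn g M.BS := fun x hx y hy h => by
    have := map_inf x hx y hy
    rw [inf_eq_left.2 h] at this
    exact inf_eq_left.1 this.symm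
  have key : ∀ {x}, x ∈ M.BS → joinExt g x = g x := fun hx => joinExt_of_mem mono hx
  have keyS : ∀ {S : Set M}, S ⊆ M.BS → joinExt g '' S = g '' S := fun hS =>
    Set.image_congr fun _ hx => key (hS hx)
  have ks : M.sats ⊆ M.BS := M.sats_subset_BS
  have ko : M.opens ⊆ M.BS := M.opens_subset_BS
  { toFun := joinExt g
    map_mem_sats := fun s hs => by rw [key (ks hs)]; exact map_mem_sats s hs
    map_sInf_sats := fun S hS => by
      rw [key (ks (M.sInf_mem_sats hS)), keyS (hS.trans ks), map_sInf S hS]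
    map_sup_sats := fun s hs t ht => by
      rw [key (ks (M.sup_mem_sats hs ht)), key (ks hs), key (ks ht), map_sup _ (ks hs) _ (ks ht)]
    map_bot := by rw [key BooleanSubalgebra.bot_mem, map_bot]
    map_mem_opens := fun u hu => by rw [key (ko hu)]; exact map_mem_opens u hu
    map_sSup_opens := fun S hS => by
      rw [key (ko (M.sSup_mem_opens hS)), keyS (hS.trans ko), map_sSup S hS]
    map_inf_opens := fun s hs t ht => by
      rw [key (ko (M.inf_mem_opens hs ht)), key (ko hs), key (ko ht), map_inf _ (ko hs) _ (ko ht)]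
    map_top := by rw [key BooleanSubalgebra.top_mem, map_top]
    map_inf := fun a b => by
      apply le_antisymm
      · refine le_inf (sSup_le_sSup (Set.image_mono fun x hx => ⟨hx.1, hx.2.trans inf_le_left⟩))
          (sSup_le_sSup (Set.image_mono fun x hx => ⟨hx.1, hx.2.trans inf_le_right⟩))
      · unfold joinExt
        rw [sSup_inf_sSup]
        refine iSup₂_le ?_
        rintro ⟨_, _⟩ ⟨⟨x, ⟨hx, hxa⟩, rfl⟩, ⟨y, ⟨hy, hyb⟩, rfl⟩⟩
        refine le_sSup ⟨x ⊓ y, ⟨BooleanSubalgebra.inf_mem hx hy, inf_le_inf hxa hyb⟩, ?_⟩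
        exact map_inf x hx y hy
    map_sup := fun x hx y hy => by
      rw [key (BooleanSubalgebra.sup_mem hx hy), key hx, key hy, map_sup x hx y hy]
    map_eq_sSup := fun a => by
      rw [keyS fun x hx => hx.1]; rfl }

/-- The identity Raney morphism `a ↦ ⋁ {x ∈ BS M | x ≤ a}`. -/
def id (M : MTAlg.{u}) : RaneyMor M M :=
  ofBS (fun a => a) (fun _ h => h) (fun _ _ => by simp) rfl (fun _ h => h) (fun _ _ => by simp) rfl
    (fun _ _ _ _ => rfl) (fun _ _ _ _ => rfl)

/-- The composition `(g ⋆ f) a = ⋁ {g (f x) | x ∈ BS M, x ≤ a}` of Raney morphisms. -/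
def star (g : RaneyMor N P) (f : RaneyMor M N) : RaneyMor M P :=
  ofBS (fun a => g (f a))
    (fun s hs => g.map_mem_sats _ (f.map_mem_sats s hs))
    (fun S hS => by
      rw [f.map_sInf_sats S hS, g.map_sInf_sats _ (Set.image_subset_iff.2 fun s hs =>
        f.map_mem_sats s (hS hs)), Set.image_image])
    (by rw [f.map_bot, g.map_bot])
    (fun s hs => g.map_mem_opens _ (f.map_mem_opens s hs))
    (fun S hS => by
      rw [f.map_sSup_opens S hS, g.map_sSup_opens _ (Set.image_subset_iff.2 fun s hs =>
        f.map_mem_opens s (hS hs)), Set.image_image])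
    (by rw [f.map_top, g.map_top])
    (fun x _ y _ => by rw [f.map_inf, g.map_inf])
    (fun x hx y hy => by
      rw [f.map_sup x hx y hy, g.map_sup _ (f.map_mem_BS hx) _ (f.map_mem_BS hy)])

theorem id_apply (a : M) : id M a = sSup {x | x ∈ M.BS ∧ x ≤ a} := by
  change sSup ((fun a => a) '' _) = _
  rw [Set.image_id']

theorem star_apply (g : RaneyMor N P) (f : RaneyMor M N) (a : M) :
    star g f a = sSup ((fun x => g (f x)) '' {x | x ∈ M.BS ∧ x ≤ a}) := rfl

theorem id_of_mem {x : M} (hx : x ∈ M.BS) : id M x = x :=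
  joinExt_of_mem (fun _ _ _ _ h => h) hx

theorem star_of_mem (g : RaneyMor N P) (f : RaneyMor M N) {x : M} (hx : x ∈ M.BS) :
    star g f x = g (f x) :=
  joinExt_of_mem (g := fun a => g (f a)) (fun _ _ _ _ h => g.mono (f.mono h)) hx

/-- Raney morphisms that agree on `BS M` are equal. -/
theorem ext_BS {f g : RaneyMor M N} (h : ∀ x ∈ M.BS, f x = g x) : f = g := by
  ext a
  rw [f.map_eq_sSup, g.map_eq_sSup, Set.image_congr fun x hx => h x hx.1]

end RaneyMor

/-- The category of MT-algebras and Raney morphisms. -/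
instance : Category MTAlg.{u} where
  Hom := RaneyMor
  id := RaneyMor.id
  comp f g := RaneyMor.star g f
  id_comp f := RaneyMor.ext_BS fun x hx => by
    rw [RaneyMor.star_of_mem _ _ hx, RaneyMor.id_of_mem hx]
  comp_id f := RaneyMor.ext_BS fun x hx => by
    rw [RaneyMor.star_of_mem _ _ hx, RaneyMor.id_of_mem (f.map_mem_BS hx)]
  assoc f g h := RaneyMor.ext_BS fun x hx => by
    rw [RaneyMor.star_of_mem _ _ hx, RaneyMor.star_of_mem _ _ hx, RaneyMor.star_of_mem _ _ hx,
      RaneyMor.star_of_mem _ _ (f.map_mem_BS hx)]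

/-- `T₀`-algebras: each element is a join of elements `s ⊓ c`, `s` saturated and `c` closed. -/
def MTAlg.IsT0 : ObjectProperty MTAlg.{u} := fun M =>
  ∀ a : M, ∃ S : Set M,
    (∀ x ∈ S, ∃ s ∈ M.sats, ∃ c ∈ M.closeds, x = s ⊓ c) ∧ a = sSup S

/-- A Raney extension `(C, L)`: a coframe `C` with a subframe `L` that meet-generates it, such that
joins of subsets of `L` distribute over binary meets. The last condition makes the sublattice `L`,
closed under the joins and finite meets of `C`, a frame. -/
structure RaneyExt : Type (u + 1) where
  carrier : Type u
  [str : Order.Coframe carrier]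
  L : Set carrier
  top_mem : ⊤ ∈ L
  inf_mem : ∀ a ∈ L, ∀ b ∈ L, a ⊓ b ∈ L
  sSup_mem : ∀ S ⊆ L, sSup S ∈ L
  exists_eq_sInf : ∀ c : carrier, ∃ S ⊆ L, c = sInf S
  inf_sSup : ∀ (a : carrier), ∀ S ⊆ L, a ⊓ sSup S = sSup ((fun s => a ⊓ s) '' S)

namespace RaneyExt

instance : CoeSort RaneyExt.{u} (Type u) := ⟨RaneyExt.carrier⟩

instance (R : RaneyExt.{u}) : Order.Coframe R := R.str

/-- A morphism of Raney extensions: a coframe morphism that restricts to a frame morphism. -/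
@[ext]
structure Hom (R R' : RaneyExt.{u}) where
  toFun : R → R'
  map_sInf : ∀ S : Set R, toFun (sInf S) = sInf (toFun '' S)
  map_sup : ∀ a b, toFun (a ⊔ b) = toFun a ⊔ toFun b
  map_bot : toFun ⊥ = ⊥
  map_mem : ∀ u ∈ R.L, toFun u ∈ R'.L
  map_sSup : ∀ S ⊆ R.L, toFun (sSup S) = sSup (toFun '' S)
  map_inf : ∀ u ∈ R.L, ∀ v ∈ R.L, toFun (u ⊓ v) = toFun u ⊓ toFun v
  map_top : toFun ⊤ = ⊤

instance (R R' : RaneyExt.{u}) : CoeFun (Hom R R') (fun _ => R → R') := ⟨Hom.toFun⟩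

instance : Category RaneyExt.{u} where
  Hom := Hom
  id R :=
    { toFun := fun a => a
      map_sInf := fun _ => by simp
      map_sup := fun _ _ => rfl
      map_bot := rfl
      map_mem := fun _ h => h
      map_sSup := fun _ _ => by simp
      map_inf := fun _ _ _ _ => rfl
      map_top := rfl }
  comp f g :=
    { toFun := fun a => g (f a)
      map_sInf := fun S => by rw [f.map_sInf, g.map_sInf, Set.image_image]
      map_sup := fun a b => by rw [f.map_sup, g.map_sup]
      map_bot := by rw [f.map_bot, g.map_bot]
      map_mem := fun u hu => g.map_mem _ (f.map_mem u hu)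
      map_sSup := fun S hS => by
        rw [f.map_sSup S hS, g.map_sSup _ (Set.image_subset_iff.2 fun s hs =>
          f.map_mem s (hS hs)), Set.image_image]
      map_inf := fun u hu v hv => by
        rw [f.map_inf u hu v hv, g.map_inf _ (f.map_mem u hu) _ (f.map_mem v hv)]
      map_top := by rw [f.map_top, g.map_top] }

end RaneyExt

namespace MTAlg

/-- The saturated elements in the order inherited from `M`. Arbitrary meets, finite joins and the
bounds are those of `M`; a join is the least saturated upper bound. -/
instance (M : MTAlg.{u}) : CompleteLattice M.sats where
  sup a b := ⟨a.1 ⊔ b.1, M.sup_mem_sats a.2 b.2⟩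
  inf a b := ⟨a.1 ⊓ b.1, M.inf_mem_sats a.2 b.2⟩
  le_sup_left a b := le_sup_left (a := a.1)
  le_sup_right a b := le_sup_right (a := a.1)
  sup_le a b c h h' := show a.1 ⊔ b.1 ≤ c.1 from sup_le h h'
  inf_le_left a b := inf_le_left (a := a.1)
  inf_le_right a b := inf_le_right (a := a.1)
  le_inf a b c h h' := show a.1 ≤ b.1 ⊓ c.1 from le_inf h h'
  top := ⟨⊤, M.top_mem_sats⟩
  bot := ⟨⊥, M.bot_mem_sats⟩
  le_top a := le_top (a := a.1)
  bot_le a := bot_le (a := a.1)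
  sInf S := ⟨sInf (Subtype.val '' S), M.sInf_mem_sats (by rintro _ ⟨x, _, rfl⟩; exact x.2)⟩
  sSup S := ⟨sInf {t | t ∈ M.sats ∧ ∀ s ∈ S, s.1 ≤ t}, M.sInf_mem_sats fun _ h => h.1⟩
  isLUB_sSup S := ⟨fun a ha => show a.1 ≤ _ from le_sInf fun _ ht => ht.2 a ha,
    fun b hb => show _ ≤ b.1 from sInf_le ⟨b.2, fun _ hs => hb hs⟩⟩
  isGLB_sInf S := ⟨fun a ha => show _ ≤ a.1 from sInf_le ⟨a, ha, rfl⟩,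
    fun b hb => show b.1 ≤ _ from le_sInf (by rintro _ ⟨x, hx, rfl⟩; exact hb hx)⟩

theorem coe_sInf_sats {M : MTAlg.{u}} (S : Set M.sats) :
    ((sInf S : M.sats) : M) = sInf (Subtype.val '' S) := rfl

/-- A join of saturated elements of `M` that happens to be saturated is their join in `sats`. -/
theorem coe_sSup_sats {M : MTAlg.{u}} (S : Set M.sats) (h : sSup (Subtype.val '' S) ∈ M.sats) :
    ((sSup S : M.sats) : M) = sSup (Subtype.val '' S) := by
  apply le_antisymm
  · exact sInf_le ⟨h, fun s hs => le_sSup ⟨s, hs, rfl⟩⟩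
  · refine le_sInf fun t ht => sSup_le ?_
    rintro _ ⟨x, hx, rfl⟩
    exact ht.2 x hx

/-- The saturated elements form a coframe. -/
instance (M : MTAlg.{u}) : Order.Coframe M.sats :=
  Order.Coframe.ofMinimalAxioms
    { iInf_sup_le_sup_sInf := fun a S => by
        change ((⨅ b ∈ S, a ⊔ b : M.sats) : M) ≤ a.1 ⊔ sInf (Subtype.val '' S)
        rw [sup_sInf_eq]
        refine le_iInf₂ ?_
        rintro _ ⟨x, hx, rfl⟩
        exact iInf₂_le (α := M.sats) (f := fun b _ => a ⊔ b) x hx }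

/-- The Raney extension `(sats M, opens M)` of an MT-algebra. -/
abbrev toRaneyExt (M : MTAlg.{u}) : RaneyExt.{u} where
  carrier := M.sats
  L := {s | s.1 ∈ M.opens}
  top_mem := M.top_mem_opens
  inf_mem _ ha _ hb := M.inf_mem_opens ha hb
  sSup_mem S hS := by
    have h : sSup (Subtype.val '' S) ∈ M.opens :=
      M.sSup_mem_opens (by rintro _ ⟨x, hx, rfl⟩; exact hS hx)
    change ((sSup S : M.sats) : M) ∈ M.opens
    rw [coe_sSup_sats S (M.opens_subset_sats h)]
    exact h
  exists_eq_sInf c := by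
    obtain ⟨S, hS, h⟩ := c.2
    refine ⟨Subtype.val ⁻¹' S, fun s hs => hS hs, Subtype.ext ?_⟩
    rw [coe_sInf_sats, Subtype.image_preimage_coe,
      Set.inter_eq_right.2 (hS.trans M.opens_subset_sats), h]
  inf_sSup a S hS := by
    have h : sSup (Subtype.val '' S) ∈ M.opens :=
      M.sSup_mem_opens (by rintro _ ⟨x, hx, rfl⟩; exact hS hx)
    have e : a.1 ⊓ sSup (Subtype.val '' S) = sSup (Subtype.val '' ((fun s => a ⊓ s) '' S)) := by
      rw [inf_sSup_eq, Set.image_image, sSup_image, iSup_image]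
      rfl
    apply Subtype.ext
    rw [coe_sSup_sats _ (by
      rw [← e]; exact M.inf_mem_sats a.2 (M.opens_subset_sats h)), ← e]
    change a.1 ⊓ ((sSup S : M.sats) : M) = _
    rw [coe_sSup_sats S (M.opens_subset_sats h)]

end MTAlg

namespace RaneyMor

variable {M N : MTAlg.{u}}

/-- The restriction of a Raney morphism to saturated elements. -/
def res (f : RaneyMor M N) (s : M.sats) : N.sats := ⟨f s.1, f.map_mem_sats s.1 s.2⟩

theorem res_sInf (f : RaneyMor M N) (S : Set M.sats) : res f (sInf S) = sInf (res f '' S) := by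
  apply Subtype.ext
  change f (sInf (Subtype.val '' S)) = sInf (Subtype.val '' (res f '' S))
  rw [f.map_sInf_sats _ (by rintro _ ⟨x, _, rfl⟩; exact x.2), Set.image_image, Set.image_image]
  rfl

theorem res_sSup (f : RaneyMor M N) (S : Set M.sats) (hS : ∀ s ∈ S, s.1 ∈ M.opens) :
    res f (sSup S) = sSup (res f '' S) := by
  have hS' : Subtype.val '' S ⊆ M.opens := by rintro _ ⟨x, hx, rfl⟩; exact hS x hx
  have e := f.map_sSup_opens _ hS'
  rw [Set.image_image] at e
  have e' : Subtype.val '' (res f '' S) = (fun s : M.sats => f s.1) '' S := by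
    rw [Set.image_image]; rfl
  apply Subtype.ext
  rw [MTAlg.coe_sSup_sats (res f '' S), e', ← e]
  · change f ((sSup S : M.sats) : M) = _
    rw [MTAlg.coe_sSup_sats S (M.opens_subset_sats (M.sSup_mem_opens hS'))]
  · rw [e', ← e]
    exact N.opens_subset_sats (f.map_mem_opens _ (M.sSup_mem_opens hS'))

end RaneyMor

/-- The functor sending `M` to `(sats M, opens M)` and a Raney morphism to its restriction. -/
def raneyFunctor : MTAlg.{u} ⥤ RaneyExt.{u} where
  obj := MTAlg.toRaneyExt
  map f :=
    { toFun := RaneyMor.res f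
      map_sInf := RaneyMor.res_sInf f
      map_sup := fun a b => Subtype.ext (RaneyMor.map_sup_sats f _ a.2 _ b.2)
      map_bot := Subtype.ext (RaneyMor.map_bot f)
      map_mem := fun u hu => RaneyMor.map_mem_opens f u.1 hu
      map_sSup := fun S hS => RaneyMor.res_sSup f S fun _ hs => hS hs
      map_inf := fun _ _ _ _ => Subtype.ext (RaneyMor.map_inf f _ _)
      map_top := Subtype.ext (RaneyMor.map_top f) }
  map_id M := RaneyExt.Hom.ext (funext fun s => Subtype.ext
    (RaneyMor.id_of_mem (M.sats_subset_BS s.2)))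
  map_comp {M _ P} f g := RaneyExt.Hom.ext (funext fun s => Subtype.ext
    (RaneyMor.star_of_mem (P := P) g f (M.sats_subset_BS s.2)))

/-- The boolean envelope of a bounded distributive lattice `C`: the boolean subalgebra generated by
`C` inside the powerset of the set of its prime filters, given as bounded lattice homomorphisms
`C → Prop`, an element `c` being represented by the set of those that contain it. -/
def BoolEnv (C : Type u) [DistribLattice C] [BoundedOrder C] : Type u :=
  BooleanSubalgebra.closure (Set.range fun c : C => {p : BoundedLatticeHom C Prop | p c})

namespace BoolEnv

variable {C D E : Type u} [DistribLattice C] [BoundedOrder C] [DistribLattice D] [BoundedOrder D]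
  [DistribLattice E] [BoundedOrder E]

instance : BooleanAlgebra (BoolEnv C) :=
  inferInstanceAs (BooleanAlgebra (BooleanSubalgebra.closure
    (Set.range fun c : C => {p : BoundedLatticeHom C Prop | p c})))

/-- The embedding of a lattice in its boolean envelope. -/
def of (c : C) : BoolEnv C := ⟨{p | p c}, BooleanSubalgebra.subset_closure ⟨c, rfl⟩⟩

theorem of_sup (a b : C) : of (a ⊔ b) = of a ⊔ of b :=
  Subtype.ext (Set.ext fun p => iff_of_eq (SupHomClass.map_sup p a b))

theorem of_inf (a b : C) : of (a ⊓ b) = of a ⊓ of b :=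
  Subtype.ext (Set.ext fun p => iff_of_eq (InfHomClass.map_inf p a b))

theorem of_bot : of (⊥ : C) = ⊥ :=
  Subtype.ext (Set.ext fun p => iff_of_eq (BotHomClass.map_bot p))

theorem of_top : of (⊤ : C) = ⊤ :=
  Subtype.ext (Set.ext fun p => iff_of_eq (TopHomClass.map_top p))

theorem of_le_of {a b : C} : of a ≤ of b ↔ a ≤ b := by
  constructor
  · intro h
    by_contra hab
    have hd : Disjoint (Order.PFilter.principal a : Set C) (Order.Ideal.principal b : Set C) :=
      Set.disjoint_left.2 fun x hx hx' => hab (le_trans hx hx')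
    obtain ⟨J, hJ, hbJ, haJ⟩ := DistribLattice.prime_ideal_of_disjoint_filter_ideal hd
    have ha : a ∉ J := Set.disjoint_left.1 haJ (show a ≤ a from le_rfl)
    have hb : b ∈ J := hbJ (show b ≤ b from le_rfl)
    let p : BoundedLatticeHom C Prop :=
      { toFun := fun c => c ∉ J
        map_sup' := fun x y => propext (by
          change _ ↔ (_ ∨ _)
          rw [Order.Ideal.sup_mem_iff, not_and_or])
        map_inf' := fun x y => propext (by
          change _ ↔ (_ ∧ _)
          rw [← not_or]
          exact not_congr ⟨fun h => hJ.mem_or_mem h, fun h => h.elim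
            (fun h => J.lower inf_le_left h) fun h => J.lower inf_le_right h⟩)
        map_top' := propext (iff_true_intro fun h => ha (J.lower le_top h))
        map_bot' := propext (iff_false_intro fun h => h J.bot_mem) }
    exact h (show p ∈ {p : BoundedLatticeHom C Prop | p a} from ha) hb
  · intro h p hp
    exact (OrderHomClass.mono p h : p a ≤ p b) hp

theorem induction {P : BoolEnv C → Prop} (hof : ∀ c, P (of c))
    (hsup : ∀ x y, P x → P y → P (x ⊔ y)) (hcompl : ∀ x, P x → P xᶜ) (x : BoolEnv C) : P x := by
  obtain ⟨x, hx⟩ := x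
  induction hx using BooleanSubalgebra.closure_bot_sup_induction with
  | mem x hx => obtain ⟨c, rfl⟩ := hx; exact hof c
  | bot => have := hof ⊥; rw [of_bot] at this; exact this
  | sup x hx y hy ihx ihy => exact hsup ⟨x, hx⟩ ⟨y, hy⟩ ihx ihy
  | compl x hx ih => exact hcompl ⟨x, hx⟩ ih

theorem induction_sdiff {P : BoolEnv C → Prop} (hsdiff : ∀ a b, P (of a \ of b))
    (hsup : ∀ x y, P x → P y → P (x ⊔ y)) (x : BoolEnv C) : P x := by
  obtain ⟨x, hx⟩ := x
  induction x, hx using BooleanSubalgebra.closure_sdiff_sup_induction with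
  | isSublattice =>
    constructor
    · rintro _ ⟨a, rfl⟩ _ ⟨b, rfl⟩
      exact ⟨a ⊔ b, congrArg Subtype.val (of_sup a b)⟩
    · rintro _ ⟨a, rfl⟩ _ ⟨b, rfl⟩
      exact ⟨a ⊓ b, congrArg Subtype.val (of_inf a b)⟩
  | bot_mem => exact ⟨⊥, congrArg Subtype.val of_bot⟩
  | top_mem => exact ⟨⊤, congrArg Subtype.val of_top⟩
  | sdiff x hx y hy => obtain ⟨a, rfl⟩ := hx; obtain ⟨b, rfl⟩ := hy; exact hsdiff a b
  | sup x hx y hy ihx ihy => exact hsup ⟨x, hx⟩ ⟨y, hy⟩ ihx ihy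

/-- The boolean morphism between boolean envelopes that extends a bounded lattice homomorphism. -/
def map (h : BoundedLatticeHom C D) : BoundedLatticeHom (BoolEnv C) (BoolEnv D) where
  toFun x := ⟨(fun q : BoundedLatticeHom D Prop => q.comp h) ⁻¹' x.1, by
    obtain ⟨x, hx⟩ := x
    induction hx using BooleanSubalgebra.closure_bot_sup_induction with
    | mem x hx => obtain ⟨c, rfl⟩ := hx; exact (of (h c)).2
    | bot => exact BooleanSubalgebra.bot_mem
    | sup x hx y hy ihx ihy => exact BooleanSubalgebra.sup_mem ihx ihy
    | compl x hx ih => exact BooleanSubalgebra.compl_mem ih⟩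
  map_sup' _ _ := rfl
  map_inf' _ _ := rfl
  map_top' := rfl
  map_bot' := rfl

theorem map_of (h : BoundedLatticeHom C D) (c : C) : map h (of c) = of (h c) := rfl

theorem map_id (x : BoolEnv C) : map (BoundedLatticeHom.id C) x = x := rfl

theorem map_comp (g : BoundedLatticeHom D E) (f : BoundedLatticeHom C D) (x : BoolEnv C) :
    map (g.comp f) x = map g (map f x) := rfl

end BoolEnv

namespace DedekindCut

variable {B : Type u} [BooleanAlgebra B]

theorem le_of_forall_principal {x y : DedekindCut B}
    (h : ∀ p, principal p ≤ x → principal p ≤ y) : x ≤ y := fun p hp =>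
  principal_le_iff.1 (h p (principal_le_iff.2 hp))

theorem principal_le_of_forall {p : B} {y : DedekindCut B}
    (h : ∀ q, y ≤ principal q → p ≤ q) : principal p ≤ y := by
  rw [principal_le_iff, ← lowerBounds_right]
  exact fun q hq => h q (le_principal_iff.2 hq)

theorem principal_eq_sSup (x : DedekindCut B) : x = sSup (principal '' x.left) := by
  apply le_antisymm
  · exact le_of_forall_principal fun p hp => le_sSup ⟨p, principal_le_iff.1 hp, rfl⟩
  · refine sSup_le ?_
    rintro _ ⟨p, hp, rfl⟩
    exact principal_le_iff.2 hp

theorem principal_inf (a b : B) : principal (a ⊓ b) = principal a ⊓ principal b := by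
  apply le_antisymm
  · exact le_inf (principal_le_principal.2 inf_le_left) (principal_le_principal.2 inf_le_right)
  · exact le_of_forall_principal fun p hp => principal_le_principal.2 (le_inf
      (principal_le_principal.1 (hp.trans inf_le_left))
      (principal_le_principal.1 (hp.trans inf_le_right)))

theorem principal_sup (a b : B) : principal (a ⊔ b) = principal a ⊔ principal b := by
  apply le_antisymm
  · exact principal_le_of_forall fun q hq => sup_le
      (principal_le_principal.1 (le_sup_left.trans hq))
      (principal_le_principal.1 (le_sup_right.trans hq))
  · exact sup_le (principal_le_principal.2 le_sup_left) (principal_le_principal.2 le_sup_right)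

theorem principal_top : principal (⊤ : B) = ⊤ :=
  top_le_iff.1 (le_of_forall_principal fun _ _ => principal_le_principal.2 le_top)

theorem principal_bot : principal (⊥ : B) = ⊥ :=
  le_bot_iff.1 (principal_le_of_forall fun _ _ => bot_le)

/-- The complement of a cut consists of the complements of its upper bounds. -/
def complCut (A : DedekindCut B) : DedekindCut B where
  extent := {x | xᶜ ∈ A.right}
  intent := {x | xᶜ ∈ A.left}
  upperPolar_extent := by
    ext x
    change (∀ y, yᶜ ∈ A.right → y ≤ x) ↔ xᶜ ∈ A.left
    rw [← lowerBounds_right]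
    constructor
    · intro h y hy
      exact compl_le_iff_compl_le.1 (h yᶜ (by rwa [compl_compl]))
    · intro h y hy
      exact compl_le_compl_iff_le.1 (h hy)
  lowerPolar_intent := by
    ext x
    change (∀ y, yᶜ ∈ A.left → x ≤ y) ↔ xᶜ ∈ A.right
    rw [← upperBounds_left]
    constructor
    · intro h y hy
      exact le_compl_comm.1 (h yᶜ (by rwa [compl_compl]))
    · intro h y hy
      exact compl_le_compl_iff_le.1 (h hy)

theorem principal_le_complCut {A : DedekindCut B} {p : B} :
    principal p ≤ complCut A ↔ A ≤ principal pᶜ := by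
  rw [principal_le_iff, le_principal_iff]; rfl

theorem inf_complCut_le_bot (A : DedekindCut B) : A ⊓ complCut A ≤ ⊥ := by
  refine le_of_forall_principal fun p hp => ?_
  have h1 := hp.trans inf_le_left
  have h2 := principal_le_complCut.1 (hp.trans inf_le_right)
  have h3 : p ≤ pᶜ := principal_le_principal.1 (h1.trans h2)
  have h4 : p = ⊥ := by simpa using h3
  rw [h4, principal_bot]

theorem complCut_principal_le_iff {A : DedekindCut B} {q : B} :
    complCut A ≤ principal q ↔ principal qᶜ ≤ A := by
  rw [principal_le_iff, le_principal_iff]; rfl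

/-- The MacNeille completion of a boolean algebra is a complete boolean algebra. -/
instance : CompleteBooleanAlgebra (DedekindCut B) where
  le_sup_inf x y z := by
    refine le_of_forall_principal fun p hp => principal_le_of_forall fun q hq => ?_
    have hx := le_sup_left.trans hq
    have key : ∀ w : DedekindCut B, principal p ≤ x ⊔ w → principal (p ⊓ qᶜ) ≤ w := by
      intro w hw
      refine principal_le_of_forall fun t ht => ?_
      have : x ⊔ w ≤ principal (q ⊔ t) := sup_le
        (hx.trans (principal_le_principal.2 le_sup_left))
        (ht.trans (principal_le_principal.2 le_sup_right))
      have h := principal_le_principal.1 (hw.trans this)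
      rw [← sdiff_eq, sdiff_le_iff]
      exact h
    have h : principal (p ⊓ qᶜ) ≤ principal q :=
      (le_inf (key y (hp.trans inf_le_left)) (key z (hp.trans inf_le_right))).trans
        (le_sup_right.trans hq)
    have h' := principal_le_principal.1 h
    rw [← sdiff_eq, sdiff_le_iff, sup_idem] at h'
    exact h'
  compl := complCut
  inf_compl_le_bot := inf_complCut_le_bot
  top_le_sup_compl A := by
    refine le_of_forall_principal fun p _ => principal_le_of_forall fun q hq => ?_
    have h1 := le_sup_left.trans hq
    have h2 := complCut_principal_le_iff.1 (le_sup_right.trans hq)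
    have h3 : qᶜ ≤ q := principal_le_principal.1 (h2.trans h1)
    have h4 : q = ⊤ := by simpa using h3
    rw [h4]; exact le_top

theorem principal_compl (a : B) : principal aᶜ = (principal a)ᶜ := by
  refine (IsCompl.compl_eq (IsCompl.of_eq ?_ ?_)).symm
  · rw [← principal_inf, inf_compl_self, principal_bot]
  · rw [← principal_sup, sup_compl_eq_top, principal_top]

end DedekindCut

namespace RaneyExt

open DedekindCut

variable (R : RaneyExt.{u}) {R' R'' : RaneyExt.{u}}

/-- The embedding of `C` in the MacNeille completion of its boolean envelope. -/
def emb (c : R) : DedekindCut (BoolEnv R) := principal (BoolEnv.of c)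

theorem emb_le_emb {a b : R} : R.emb a ≤ R.emb b ↔ a ≤ b :=
  principal_le_principal.trans BoolEnv.of_le_of

theorem emb_inf (a b : R) : R.emb (a ⊓ b) = R.emb a ⊓ R.emb b := by
  rw [emb, BoolEnv.of_inf, principal_inf]; rfl

theorem emb_sup (a b : R) : R.emb (a ⊔ b) = R.emb a ⊔ R.emb b := by
  rw [emb, BoolEnv.of_sup, principal_sup]; rfl

theorem emb_top : R.emb ⊤ = ⊤ := by rw [emb, BoolEnv.of_top, principal_top]

theorem emb_bot : R.emb ⊥ = ⊥ := by rw [emb, BoolEnv.of_bot, principal_bot]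

theorem emb_sSup {S : Set R} (hS : S ⊆ R.L) : R.emb (sSup S) = sSup (R.emb '' S) := by
  apply le_antisymm
  · refine principal_le_of_forall fun q hq => ?_
    have h : ∀ s ∈ S, BoolEnv.of s ≤ q := fun s hs =>
      principal_le_principal.1 (le_trans (le_sSup (Set.mem_image_of_mem R.emb hs)) hq)
    suffices H : ∀ q : BoolEnv R, (∀ s ∈ S, BoolEnv.of s ⊓ q = ⊥) →
        BoolEnv.of (sSup S) ⊓ q = ⊥ by
      have := H qᶜ fun s hs => by
        rw [← sdiff_eq, sdiff_eq_bot_iff]; exact h s hs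
      rwa [← sdiff_eq, sdiff_eq_bot_iff] at this
    intro q
    induction q using BoolEnv.induction_sdiff with
    | hsdiff a b =>
      have e : ∀ c : R, BoolEnv.of c ⊓ (BoolEnv.of a \ BoolEnv.of b) = ⊥ ↔ a ⊓ c ≤ b := fun c => by
        rw [← inf_sdiff_assoc, sdiff_eq_bot_iff, ← BoolEnv.of_inf, BoolEnv.of_le_of, inf_comm]
      simp only [e]
      intro h
      rw [R.inf_sSup a S hS]
      refine sSup_le ?_
      rintro _ ⟨s, hs, rfl⟩
      exact h s hs
    | hsup x y hx hy =>
      simp only [inf_sup_left, sup_eq_bot_iff]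
      exact fun h => ⟨hx fun s hs => (h s hs).1, hy fun s hs => (h s hs).2⟩
  · refine sSup_le ?_
    rintro _ ⟨s, hs, rfl⟩
    exact R.emb_le_emb.2 (le_sSup hs)

theorem emb_sInf (S : Set R) : R.emb (sInf S) = sInf (R.emb '' S) := by
  apply le_antisymm
  · refine le_sInf ?_
    rintro _ ⟨s, hs, rfl⟩
    exact R.emb_le_emb.2 (sInf_le hs)
  · refine le_of_forall_principal fun q hq => principal_le_principal.2 ?_
    have h : ∀ s ∈ S, q ≤ BoolEnv.of s := fun s hs =>
      principal_le_principal.1 (le_trans hq (sInf_le (Set.mem_image_of_mem R.emb hs)))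
    clear hq
    induction q using BoolEnv.induction_sdiff with
    | hsdiff a b =>
      simp only [sdiff_le_iff, ← BoolEnv.of_sup, BoolEnv.of_le_of] at h ⊢
      rw [sup_sInf_eq]
      exact le_iInf₂ h
    | hsup x y hx hy =>
      exact sup_le (hx fun s hs => le_sup_left.trans (h s hs))
        (hy fun s hs => le_sup_right.trans (h s hs))

/-- The Funayama envelope: the MacNeille completion of the boolean envelope of `C`, with the
interior operator given by the right adjoint of the embedding of `L`. -/
abbrev funayama : MTAlg.{u} where
  carrier := DedekindCut (BoolEnv R)
  box a := sSup (R.emb '' {u | u ∈ R.L ∧ R.emb u ≤ a})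
  box_top := top_le_iff.1 (le_sSup ⟨⊤, ⟨R.top_mem, le_top⟩, R.emb_top⟩)
  box_inf a b := by
    apply le_antisymm
    · exact le_inf (sSup_le_sSup (Set.image_mono fun x hx => ⟨hx.1, hx.2.trans inf_le_left⟩))
        (sSup_le_sSup (Set.image_mono fun x hx => ⟨hx.1, hx.2.trans inf_le_right⟩))
    · rw [sSup_inf_sSup]
      refine iSup₂_le ?_
      rintro ⟨_, _⟩ ⟨⟨x, ⟨hx, hxa⟩, rfl⟩, ⟨y, ⟨hy, hyb⟩, rfl⟩⟩
      refine le_sSup ⟨x ⊓ y, ⟨R.inf_mem x hx y hy, ?_⟩, R.emb_inf x y⟩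
      rw [emb_inf]
      exact inf_le_inf hxa hyb
  box_le a := sSup_le (by rintro _ ⟨x, ⟨_, hx⟩, rfl⟩; exact hx)
  le_box_box a := sSup_le (by
    rintro _ ⟨x, ⟨hx, hxa⟩, rfl⟩
    exact le_sSup ⟨x, ⟨hx, le_sSup ⟨x, ⟨hx, hxa⟩, rfl⟩⟩, rfl⟩)

theorem mem_opens_funayama {a : R.funayama} : a ∈ R.funayama.opens ↔ ∃ u ∈ R.L, R.emb u = a := by
  constructor
  · intro h
    refine ⟨sSup {u | u ∈ R.L ∧ R.emb u ≤ a}, R.sSup_mem _ fun _ h => h.1, ?_⟩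
    rw [R.emb_sSup fun _ h => h.1]
    exact h
  · rintro ⟨u, hu, rfl⟩
    exact le_antisymm (R.funayama.box_le _) (le_sSup ⟨u, ⟨hu, le_rfl⟩, rfl⟩)

theorem mem_sats_funayama {a : R.funayama} : a ∈ R.funayama.sats ↔ ∃ c : R, R.emb c = a := by
  constructor
  · rintro ⟨S, hS, rfl⟩
    refine ⟨sInf (R.emb ⁻¹' S), ?_⟩
    rw [emb_sInf, Set.image_preimage_eq_of_subset]
    intro s hs
    obtain ⟨u, _, hu⟩ := R.mem_opens_funayama.1 (hS hs)
    exact ⟨u, hu⟩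
  · rintro ⟨c, rfl⟩
    obtain ⟨S, hS, rfl⟩ := R.exists_eq_sInf c
    refine ⟨R.emb '' S, ?_, R.emb_sInf S⟩
    rintro _ ⟨s, hs, rfl⟩
    exact R.mem_opens_funayama.2 ⟨s, hS hs, rfl⟩

theorem mem_BS_funayama {a : R.funayama} :
    a ∈ R.funayama.BS ↔ ∃ x : BoolEnv R, principal x = a := by
  constructor
  · intro h
    unfold MTAlg.BS at h
    induction h using BooleanSubalgebra.closure_bot_sup_induction with
    | mem x hx =>
      obtain ⟨c, hc⟩ := R.mem_sats_funayama.1 hx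
      exact ⟨BoolEnv.of c, hc⟩
    | bot => exact ⟨⊥, principal_bot⟩
    | sup x hx y hy ihx ihy =>
      obtain ⟨x, rfl⟩ := ihx
      obtain ⟨y, rfl⟩ := ihy
      exact ⟨x ⊔ y, principal_sup x y⟩
    | compl x hx ih =>
      obtain ⟨x, rfl⟩ := ih
      exact ⟨xᶜ, principal_compl x⟩
  · rintro ⟨x, rfl⟩
    induction x using BoolEnv.induction with
    | hof c => exact R.funayama.sats_subset_BS (R.mem_sats_funayama.2 ⟨c, rfl⟩)
    | hsup x y hx hy => rw [principal_sup]; exact BooleanSubalgebra.sup_mem hx hy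
    | hcompl x hx => rw [principal_compl]; exact BooleanSubalgebra.compl_mem hx

variable {R}

theorem Hom.map_inf' (h : Hom R R') (a b : R) : h (a ⊓ b) = h a ⊓ h b := by
  rw [← sInf_pair, h.map_sInf, Set.image_pair, sInf_pair]

/-- A morphism of Raney extensions as a bounded lattice homomorphism. -/
def Hom.toBounded (h : Hom R R') : BoundedLatticeHom R R' where
  toFun := h
  map_sup' := h.map_sup
  map_inf' := h.map_inf'
  map_top' := h.map_top
  map_bot' := h.map_bot

/-- The map `a ↦ ⋁ {B h x | x ∈ B C, x ≤ a}` between Funayama envelopes. -/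
def Hom.lift (h : Hom R R') (a : R.funayama) : R'.funayama :=
  sSup ((fun x => (principal (BoolEnv.map h.toBounded x) : DedekindCut (BoolEnv R'))) ''
    {x : BoolEnv R | principal x ≤ (a : DedekindCut (BoolEnv R))})

theorem Hom.lift_principal (h : Hom R R') (x : BoolEnv R) :
    h.lift (principal x : DedekindCut (BoolEnv R)) = principal (BoolEnv.map h.toBounded x) := by
  apply le_antisymm
  · refine sSup_le ?_
    rintro _ ⟨y, hy, rfl⟩
    exact principal_le_principal.2
      (OrderHomClass.mono (BoolEnv.map h.toBounded) (principal_le_principal.1 hy))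
  · exact le_sSup ⟨x, le_refl (principal x), rfl⟩

theorem Hom.lift_emb (h : Hom R R') (c : R) : h.lift (R.emb c) = R'.emb (h c) :=
  h.lift_principal _

/-- The Raney morphism between Funayama envelopes induced by a morphism of Raney extensions. -/
def Hom.funayama (h : Hom R R') : RaneyMor R.funayama R'.funayama where
  toFun := h.lift
  map_mem_sats s hs := by
    obtain ⟨c, rfl⟩ := R.mem_sats_funayama.1 hs
    exact R'.mem_sats_funayama.2 ⟨h c, (h.lift_emb c).symm⟩
  map_sInf_sats S hS := by
    obtain ⟨T, rfl⟩ : ∃ T : Set R, S = R.emb '' T :=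
      ⟨R.emb ⁻¹' S, (Set.image_preimage_eq_of_subset fun s hs =>
        R.mem_sats_funayama.1 (hS hs)).symm⟩
    have e : h.lift '' (R.emb '' T) = R'.emb '' (h '' T) := by
      rw [Set.image_image, Set.image_image]
      exact Set.image_congr fun c _ => h.lift_emb c
    rw [e]
    exact (congrArg h.lift (R.emb_sInf T).symm).trans
      ((h.lift_emb _).trans ((congrArg R'.emb (h.map_sInf T)).trans (R'.emb_sInf _)))
  map_sup_sats s hs t ht := by
    obtain ⟨c, rfl⟩ := R.mem_sats_funayama.1 hs
    obtain ⟨d, rfl⟩ := R.mem_sats_funayama.1 ht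
    rw [h.lift_emb, h.lift_emb]
    exact (congrArg h.lift (R.emb_sup c d).symm).trans
      ((h.lift_emb _).trans ((congrArg R'.emb (h.map_sup c d)).trans (R'.emb_sup _ _)))
  map_bot := (congrArg h.lift R.emb_bot.symm).trans
      ((h.lift_emb _).trans ((congrArg R'.emb h.map_bot).trans R'.emb_bot))
  map_mem_opens s hs := by
    obtain ⟨c, hc, rfl⟩ := R.mem_opens_funayama.1 hs
    exact R'.mem_opens_funayama.2 ⟨h c, h.map_mem c hc, (h.lift_emb c).symm⟩
  map_sSup_opens S hS := by
    obtain ⟨T, hT, rfl⟩ : ∃ T : Set R, T ⊆ R.L ∧ S = R.emb '' T := by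
      refine ⟨R.emb ⁻¹' S, fun c hc => ?_, (Set.image_preimage_eq_of_subset fun s hs =>
        R.mem_sats_funayama.1 (R.funayama.opens_subset_sats (hS hs))).symm⟩
      obtain ⟨u, hu, e⟩ := R.mem_opens_funayama.1 (hS hc)
      have : u = c := le_antisymm (R.emb_le_emb.1 e.le) (R.emb_le_emb.1 e.ge)
      exact this ▸ hu
    have e : h.lift '' (R.emb '' T) = R'.emb '' (h '' T) := by
      rw [Set.image_image, Set.image_image]
      exact Set.image_congr fun c _ => h.lift_emb c
    rw [e]
    exact (congrArg h.lift (R.emb_sSup hT).symm).trans ((h.lift_emb _).trans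
      ((congrArg R'.emb (h.map_sSup T hT)).trans
        (R'.emb_sSup (Set.image_subset_iff.2 fun s hs => h.map_mem s (hT hs)))))
  map_inf_opens s hs t ht := by
    obtain ⟨c, hc, rfl⟩ := R.mem_opens_funayama.1 hs
    obtain ⟨d, hd, rfl⟩ := R.mem_opens_funayama.1 ht
    rw [h.lift_emb, h.lift_emb]
    exact (congrArg h.lift (R.emb_inf c d).symm).trans
      ((h.lift_emb _).trans ((congrArg R'.emb (h.map_inf c hc d hd)).trans (R'.emb_inf _ _)))
  map_top := (congrArg h.lift R.emb_top.symm).trans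
      ((h.lift_emb _).trans ((congrArg R'.emb h.map_top).trans R'.emb_top))
  map_inf a b := by
    apply le_antisymm
    · exact le_inf
        (sSup_le_sSup (Set.image_mono fun x (hx : principal x ≤ _) => hx.trans inf_le_left))
        (sSup_le_sSup (Set.image_mono fun x (hx : principal x ≤ _) => hx.trans inf_le_right))
    · unfold Hom.lift
      rw [sSup_inf_sSup]
      refine iSup₂_le ?_
      rintro ⟨_, _⟩ ⟨⟨x, hx, rfl⟩, ⟨y, hy, rfl⟩⟩
      refine le_sSup ⟨x ⊓ y, ?_, ?_⟩
      · change principal (x ⊓ y) ≤ _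
        rw [principal_inf]
        exact inf_le_inf hx hy
      · change principal (BoolEnv.map h.toBounded (x ⊓ y)) = _
        rw [InfHomClass.map_inf, principal_inf]
  map_sup a ha b hb := by
    obtain ⟨x, rfl⟩ := R.mem_BS_funayama.1 ha
    obtain ⟨y, rfl⟩ := R.mem_BS_funayama.1 hb
    rw [h.lift_principal, h.lift_principal]
    refine (congrArg h.lift (principal_sup x y).symm).trans ((h.lift_principal _).trans ?_)
    rw [SupHomClass.map_sup, principal_sup]
  map_eq_sSup a := by
    have e : {x | x ∈ R.funayama.BS ∧ x ≤ a} = principal ''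
        {x : BoolEnv R | principal x ≤ (a : DedekindCut (BoolEnv R))} := by
      ext y
      constructor
      · rintro ⟨hy, hya⟩
        obtain ⟨x, rfl⟩ := R.mem_BS_funayama.1 hy
        exact ⟨x, hya, rfl⟩
      · rintro ⟨x, hx, rfl⟩
        exact ⟨R.mem_BS_funayama.2 ⟨x, rfl⟩, hx⟩
    rw [e, Set.image_image]
    simp only [h.lift_principal]
    rfl

end RaneyExt

/-- The functor sending a Raney extension to its Funayama envelope. -/
def funayamaFunctor : RaneyExt.{u} ⥤ MTAlg.{u} where
  obj := RaneyExt.funayama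
  map h := RaneyExt.Hom.funayama h
  map_id R := RaneyMor.ext_BS fun a ha => by
    obtain ⟨x, rfl⟩ := R.mem_BS_funayama.1 ha
    exact (RaneyExt.Hom.lift_principal _ x).trans (RaneyMor.id_of_mem ha).symm
  map_comp {R R' R''} f g := RaneyMor.ext_BS fun a ha => by
    obtain ⟨x, rfl⟩ := R.mem_BS_funayama.1 ha
    refine (RaneyExt.Hom.lift_principal _ x).trans (Eq.symm ((RaneyMor.star_of_mem
      (P := R''.funayama) (RaneyExt.Hom.funayama g) (RaneyExt.Hom.funayama f) ha).trans ?_))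
    exact (congrArg _ (RaneyExt.Hom.lift_principal f x)).trans
      (RaneyExt.Hom.lift_principal g _)

/-!
The functor `raneyFunctor` is fully faithful. A Raney morphism is the join-extension of its
restriction to `BS M`, and on `BS M` it is a boolean homomorphism, so it is determined by its
restriction to the saturated elements (`RaneyMor.ext_sats`). Conversely `BS M` is the boolean
envelope of the lattice of saturated elements: a bounded lattice homomorphism into a boolean
algebra extends to the boolean envelope (`BoolEnv.lift`), and the extension of an order embedding
is an order embedding (`BoolEnv.lift_le_lift`). Hence a morphism `(sats M, opens M) → (sats N,
opens N)` extends to `BS M`, and from there by joins to a Raney morphism (`MTAlg.ofRaneyHom`).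

The saturated and open elements of the Funayama envelope of `R = (C, L)` are the images of the
elements of `C` and of `L`, so the canonical embedding is a natural isomorphism (`raneyUnitIso`).
Together with full faithfulness this makes it the unit of an adjunction (`raneyAdj`), whose counit
is then an isomorphism as well. No `T₀` assumption is used: Raney morphisms only see `BS M`, and
therefore an isomorphism of MT-algebras need not be an order isomorphism.

Every element of the Funayama envelope is a join of differences of elements of `C`, and elements of
`C` are meets of elements of `L`, so the envelope is a `T₀`-algebra (`RaneyExt.isT0_funayama`). The
statements on the full subcategory and on the reflector are obtained by restricting the adjunction
and inverting its counit.

In a `T₀`-algebra `M` the subalgebra `BS M` is join-dense and meet-dense, so `M` is its MacNeille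
completion (`DedekindCut.isoOfDense`). An isomorphism `(sats M, opens M) ≅ R` identifies `BS M`
with the boolean envelope of `C`, which gives the order isomorphism of `M` with the Funayama
envelope (`RaneyExt.exists_hullIso`); it respects the interior operators because it maps opens onto
opens, and it is unique because `BS M` is generated by the saturated elements.
-/

/-! ### The universal property of the boolean envelope -/

namespace BoolEnv

variable {C B : Type u} [DistribLattice C] [BoundedOrder C] [BooleanAlgebra B]

theorem of_compl (b : B) : of bᶜ = (of b)ᶜ := by
  refine (IsCompl.compl_eq (IsCompl.of_eq ?_ ?_)).symm
  · rw [← of_inf, inf_compl_self, of_bot]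
  · rw [← of_sup, sup_compl_eq_top, of_top]

theorem of_surjective : Function.Surjective (of : B → BoolEnv B) := by
  intro x
  induction x using BoolEnv.induction with
  | hof c => exact ⟨c, rfl⟩
  | hsup x y hx hy =>
    obtain ⟨a, rfl⟩ := hx
    obtain ⟨b, rfl⟩ := hy
    exact ⟨a ⊔ b, of_sup a b⟩
  | hcompl x hx =>
    obtain ⟨a, rfl⟩ := hx
    exact ⟨aᶜ, of_compl a⟩

/-- A boolean algebra is its own boolean envelope. -/
noncomputable def ofIso (B : Type u) [BooleanAlgebra B] : B ≃o BoolEnv B :=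
  RelIso.ofSurjective (OrderEmbedding.ofMapLEIff (of : B → BoolEnv B) fun _ _ => of_le_of)
    of_surjective

/-- The universal property of the boolean envelope: a bounded lattice homomorphism into a boolean
algebra extends to the boolean envelope. -/
noncomputable def lift (h : BoundedLatticeHom C B) : BoundedLatticeHom (BoolEnv C) B :=
  ((ofIso B).symm : BoundedLatticeHom (BoolEnv B) B).comp (map h)

theorem lift_of (h : BoundedLatticeHom C B) (c : C) : lift h (of c) = h c :=
  (ofIso B).symm_apply_apply (h c)

/-- The extension of an order embedding is an order embedding: every element is a finite join of
differences `of a \ of b`, and `h a \ h b = ⊥` forces `a ≤ b`. -/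
theorem lift_le_lift {h : BoundedLatticeHom C B} (hh : ∀ a b, h a ≤ h b → a ≤ b)
    {x y : BoolEnv C} : lift h x ≤ lift h y ↔ x ≤ y := by
  refine ⟨fun hxy => ?_, fun hxy => OrderHomClass.mono (lift h) hxy⟩
  have key : ∀ z : BoolEnv C, lift h z = ⊥ → z = ⊥ := by
    intro z
    induction z using BoolEnv.induction_sdiff with
    | hsdiff a b =>
      rw [map_sdiff', lift_of, lift_of, sdiff_eq_bot_iff, sdiff_eq_bot_iff, of_le_of]
      exact hh a b
    | hsup x y hx hy =>
      rw [SupHomClass.map_sup, sup_eq_bot_iff, sup_eq_bot_iff]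
      exact fun h => ⟨hx h.1, hy h.2⟩
  rw [← sdiff_eq_bot_iff]
  apply key
  rw [map_sdiff', sdiff_eq_bot_iff]
  exact hxy

end BoolEnv

/-! ### Uniqueness of the MacNeille completion of a boolean algebra -/

namespace DedekindCut

/-- A boolean algebra `B` that embeds join-densely and meet-densely in a complete lattice `A` has
`A` as its MacNeille completion. -/
noncomputable def isoOfDense {A B : Type u} [CompleteLattice A] [BooleanAlgebra B] (γ : B ↪o A)
    (hj : ∀ a b : A, (∀ x, γ x ≤ a → γ x ≤ b) → a ≤ b)
    (hm : ∀ a b : A, (∀ x, b ≤ γ x → a ≤ γ x) → a ≤ b) : DedekindCut B ≃o A :=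
  RelIso.ofSurjective (factorEmbedding γ) fun a => by
    -- the cut of the elements of `B` below and above `a`
    let c : DedekindCut B :=
      { extent := {x | γ x ≤ a}
        intent := {y | a ≤ γ y}
        upperPolar_extent := by
          ext y
          exact ⟨fun h => hj _ _ fun x hx => γ.le_iff_le.2 (h hx),
            fun h x hx => γ.le_iff_le.1 (le_trans hx h)⟩
        lowerPolar_intent := by
          ext x
          exact ⟨fun h => hm _ _ fun y hy => γ.le_iff_le.2 (h hy),
            fun h y hy => γ.le_iff_le.1 (le_trans h hy)⟩ }
    refine ⟨c, ?_⟩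
    rw [factorEmbedding_apply]
    apply le_antisymm
    · refine sSup_le ?_
      rintro _ ⟨x, hx, rfl⟩
      exact hx
    · exact hj _ _ fun x hx => le_sSup ⟨x, hx, rfl⟩

theorem isoOfDense_principal {A B : Type u} [CompleteLattice A] [BooleanAlgebra B] (γ : B ↪o A)
    (hj : ∀ a b : A, (∀ x, γ x ≤ a → γ x ≤ b) → a ≤ b)
    (hm : ∀ a b : A, (∀ x, b ≤ γ x → a ≤ γ x) → a ≤ b) (x : B) :
    isoOfDense γ hj hm (principal x) = γ x :=
  factorEmbedding_principal γ x

end DedekindCut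

/-! ### Raney morphisms are morphisms of Raney extensions -/

namespace RaneyExt.Hom

variable {R : RaneyExt.{u}} {N : MTAlg.{u}}

/-- The boolean extension `BoolEnv R → N` of a morphism from `R` to the Raney extension of `N`. -/
noncomputable def envHom (k : Hom R N.toRaneyExt) : BoundedLatticeHom (BoolEnv R) N :=
  BoolEnv.lift
    { toFun := fun c => (k c).1
      map_sup' := fun a b => congrArg Subtype.val (k.map_sup a b)
      map_inf' := fun a b => congrArg Subtype.val (k.map_inf' a b)
      map_top' := congrArg Subtype.val k.map_top
      map_bot' := congrArg Subtype.val k.map_bot }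

theorem envHom_of (k : Hom R N.toRaneyExt) (c : R) : k.envHom (BoolEnv.of c) = (k c).1 :=
  BoolEnv.lift_of _ c

theorem envHom_le_envHom {k : Hom R N.toRaneyExt} (hk : ∀ a b, k a ≤ k b → a ≤ b)
    {x y : BoolEnv R} : k.envHom x ≤ k.envHom y ↔ x ≤ y :=
  BoolEnv.lift_le_lift hk

/-- `BS N` is generated by the saturated elements, so the boolean extension of a surjective morphism
reaches all of it. -/
theorem exists_envHom_eq {k : Hom R N.toRaneyExt} (hk : Function.Surjective k) {a : N}
    (ha : a ∈ N.BS) : ∃ x, k.envHom x = a := by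
  unfold MTAlg.BS at ha
  induction ha using BooleanSubalgebra.closure_bot_sup_induction with
  | mem a ha =>
    obtain ⟨c, hc⟩ := hk ⟨a, ha⟩
    exact ⟨BoolEnv.of c, by rw [envHom_of, hc]⟩
  | bot => exact ⟨⊥, BotHomClass.map_bot _⟩
  | sup a ha b hb iha ihb =>
    obtain ⟨x, rfl⟩ := iha
    obtain ⟨y, rfl⟩ := ihb
    exact ⟨x ⊔ y, SupHomClass.map_sup _ _ _⟩
  | compl a ha ih =>
    obtain ⟨x, rfl⟩ := ih
    exact ⟨xᶜ, map_compl' _ _⟩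

end RaneyExt.Hom

/-- A boolean subalgebra is determined by its generators: Raney morphisms that agree on saturated
elements agree on `BS M`, hence are equal. -/
theorem RaneyMor.ext_sats {M N : MTAlg.{u}} {f g : RaneyMor M N} (h : ∀ s ∈ M.sats, f s = g s) :
    f = g := by
  refine RaneyMor.ext_BS fun x hx => ?_
  have hx' := hx
  unfold MTAlg.BS at hx'
  induction hx' using BooleanSubalgebra.closure_bot_sup_induction with
  | mem x hx' => exact h x hx'
  | bot => rw [f.map_bot, g.map_bot]
  | sup x hx' y hy' ihx ihy => rw [f.map_sup x hx' y hy', g.map_sup x hx' y hy', ihx hx', ihy hy']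
  | compl x hx' ih => rw [f.map_compl hx', g.map_compl hx', ih hx']

namespace MTAlg

variable {M N : MTAlg.{u}}

/-- The identity of `toRaneyExt M`, whose boolean extension is an isomorphism from the boolean
envelope of the saturated elements onto `BS M`. -/
abbrev idHom (M : MTAlg.{u}) : RaneyExt.Hom M.toRaneyExt M.toRaneyExt := 𝟙 M.toRaneyExt

/-- The boolean extension of a Raney extension morphism `h`, transported along the isomorphism
between the boolean envelope of the saturated elements and `BS M`. Only its values on `BS M` are
meaningful. -/
noncomputable def extBS (h : RaneyExt.Hom M.toRaneyExt N.toRaneyExt) (a : M) : N :=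
  h.envHom (Function.invFun M.idHom.envHom a)

theorem extBS_envHom (h : RaneyExt.Hom M.toRaneyExt N.toRaneyExt) (x : BoolEnv M.toRaneyExt) :
    extBS h (M.idHom.envHom x) = h.envHom x := by
  have hi : Function.Injective M.idHom.envHom := fun x y hxy => le_antisymm
    ((RaneyExt.Hom.envHom_le_envHom fun _ _ h => h).1 hxy.le)
    ((RaneyExt.Hom.envHom_le_envHom fun _ _ h => h).1 hxy.ge)
  rw [extBS, Function.leftInverse_invFun hi x]

theorem extBS_sats (h : RaneyExt.Hom M.toRaneyExt N.toRaneyExt) {s : M} (hs : s ∈ M.sats) :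
    extBS h s = (h ⟨s, hs⟩).1 := by
  have := extBS_envHom h (BoolEnv.of ⟨s, hs⟩)
  rwa [RaneyExt.Hom.envHom_of, RaneyExt.Hom.envHom_of] at this

theorem exists_idHom_envHom_eq {a : M} (ha : a ∈ M.BS) : ∃ x, M.idHom.envHom x = a :=
  RaneyExt.Hom.exists_envHom_eq (fun a => ⟨a, rfl⟩) ha

/-- The Raney morphism that restricts to a given morphism of Raney extensions. -/
noncomputable def ofRaneyHom (h : RaneyExt.Hom M.toRaneyExt N.toRaneyExt) : RaneyMor M N :=
  -- Sets of saturated elements are rewritten as images of sets of `M.sats`, where `h` applies.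
  have image_eq : ∀ S : Set M.sats, extBS h '' (Subtype.val '' S) = Subtype.val '' (h '' S) := by
    intro S
    rw [Set.image_image, Set.image_image]
    exact Set.image_congr fun s _ => extBS_sats h s.2
  have lift_set : ∀ S : Set M, S ⊆ M.sats → ∃ T : Set M.sats, S = Subtype.val '' T := fun S hS =>
    ⟨Subtype.val ⁻¹' S, by rw [Subtype.image_preimage_coe, Set.inter_eq_right.2 hS]⟩
  RaneyMor.ofBS (extBS h)
    (fun s hs => by rw [extBS_sats h hs]; exact (h _).2)
    (fun S hS => by
      obtain ⟨T, rfl⟩ := lift_set S hS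
      rw [image_eq, ← coe_sInf_sats, ← coe_sInf_sats, extBS_sats h (Subtype.prop _)]
      exact congrArg Subtype.val (h.map_sInf T))
    (by rw [extBS_sats h M.bot_mem_sats]; exact congrArg Subtype.val h.map_bot)
    (fun u hu => by
      rw [extBS_sats h (M.opens_subset_sats hu)]
      exact h.map_mem ⟨u, _⟩ hu)
    (fun S hS => by
      obtain ⟨T, rfl⟩ := lift_set S (hS.trans M.opens_subset_sats)
      have hT : T ⊆ M.toRaneyExt.L := fun t ht => hS ⟨t, ht, rfl⟩
      have hN : sSup (Subtype.val '' (h '' T)) ∈ N.opens := N.sSup_mem_opens (by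
        rintro _ ⟨_, ⟨t, ht, rfl⟩, rfl⟩
        exact h.map_mem t (hT ht))
      rw [image_eq, ← coe_sSup_sats _ (N.opens_subset_sats hN),
        ← coe_sSup_sats _ (M.opens_subset_sats (M.sSup_mem_opens hS)),
        extBS_sats h (Subtype.prop _)]
      exact congrArg Subtype.val (h.map_sSup T hT))
    (by rw [extBS_sats h M.top_mem_sats]; exact congrArg Subtype.val h.map_top)
    (fun x hx y hy => by
      obtain ⟨x, rfl⟩ := exists_idHom_envHom_eq hx
      obtain ⟨y, rfl⟩ := exists_idHom_envHom_eq hy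
      have e := extBS_envHom h (x ⊓ y)
      rw [InfHomClass.map_inf, InfHomClass.map_inf] at e
      rw [extBS_envHom h x, extBS_envHom h y]
      exact e)
    (fun x hx y hy => by
      obtain ⟨x, rfl⟩ := exists_idHom_envHom_eq hx
      obtain ⟨y, rfl⟩ := exists_idHom_envHom_eq hy
      have e := extBS_envHom h (x ⊔ y)
      rw [SupHomClass.map_sup, SupHomClass.map_sup] at e
      rw [extBS_envHom h x, extBS_envHom h y]
      exact e)

theorem ofRaneyHom_sats (h : RaneyExt.Hom M.toRaneyExt N.toRaneyExt) {s : M} (hs : s ∈ M.sats) :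
    ofRaneyHom h s = (h ⟨s, hs⟩).1 := by
  refine Eq.trans (RaneyMor.joinExt_of_mem ?_ (M.sats_subset_BS hs)) (extBS_sats h hs)
  intro x hx y hy hxy
  obtain ⟨x, rfl⟩ := exists_idHom_envHom_eq hx
  obtain ⟨y, rfl⟩ := exists_idHom_envHom_eq hy
  rw [extBS_envHom, extBS_envHom]
  exact OrderHomClass.mono h.envHom ((RaneyExt.Hom.envHom_le_envHom fun _ _ h => h).1 hxy)

end MTAlg

/-- A Raney morphism is the same thing as a morphism of the associated Raney extensions. -/
noncomputable def raneyFunctorFullyFaithful : raneyFunctor.{u}.FullyFaithful where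
  preimage h := MTAlg.ofRaneyHom h
  map_preimage h := RaneyExt.Hom.ext (funext fun s => Subtype.ext (MTAlg.ofRaneyHom_sats h s.2))
  preimage_map _ := RaneyMor.ext_sats fun _ hs => MTAlg.ofRaneyHom_sats _ hs

/-! ### The adjunction -/

namespace RaneyExt

variable (R : RaneyExt.{u})

/-- The canonical embedding of `R` in the Raney extension of its Funayama envelope. -/
def toEnvelope : Hom R R.funayama.toRaneyExt where
  toFun c := ⟨R.emb c, R.mem_sats_funayama.2 ⟨c, rfl⟩⟩
  map_sInf S := Subtype.ext (by
    rw [MTAlg.coe_sInf_sats, Set.image_image]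
    exact R.emb_sInf S)
  map_sup a b := Subtype.ext (R.emb_sup a b)
  map_bot := Subtype.ext R.emb_bot
  map_mem u hu := R.mem_opens_funayama.2 ⟨u, hu, rfl⟩
  map_sSup S hS := Subtype.ext (by
    have e := R.emb_sSup hS
    have h : (Subtype.val '' ((fun c => (⟨R.emb c, R.mem_sats_funayama.2 ⟨c, rfl⟩⟩ :
        R.funayama.sats)) '' S)) = R.emb '' S := Set.image_image _ _ _
    rw [MTAlg.coe_sSup_sats, h]
    · exact e
    · rw [h]
      exact R.mem_sats_funayama.2 ⟨_, e⟩)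
  map_inf u _ v _ := Subtype.ext (R.emb_inf u v)
  map_top := Subtype.ext R.emb_top

/-- The inverse of an order isomorphism that reflects membership in `L`, as a morphism of Raney
extensions. -/
def invHom {R R' : RaneyExt.{u}} (e : R ≃o R') (hL : ∀ c, e c ∈ R'.L → c ∈ R.L) :
    Hom R' R where
  toFun := e.symm
  map_sInf S := by rw [OrderIso.map_sInf, sInf_image]
  map_sup a b := map_sup _ _ _
  map_bot := map_bot _
  map_mem u hu := hL _ (by rwa [e.apply_symm_apply])
  map_sSup S _ := by rw [OrderIso.map_sSup, sSup_image]
  map_inf _ _ _ _ := map_inf _ _ _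
  map_top := map_top _

/-- The saturated elements of the Funayama envelope are exactly the elements of `R`. -/
noncomputable def satsIso : R ≃o R.funayama.toRaneyExt :=
  RelIso.ofSurjective (OrderEmbedding.ofMapLEIff R.toEnvelope.toFun fun _ _ => R.emb_le_emb)
    fun s => (R.mem_sats_funayama.1 s.2).imp fun _ hc => Subtype.ext hc

/-- The canonical embedding as an isomorphism of Raney extensions. -/
noncomputable def envelopeIso : R ≅ raneyFunctor.obj (funayamaFunctor.obj R) where
  hom := R.toEnvelope
  inv := invHom R.satsIso fun c hc => by
    obtain ⟨u, hu, e⟩ := R.mem_opens_funayama.1 hc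
    have : u = c := le_antisymm (R.emb_le_emb.1 e.le) (R.emb_le_emb.1 e.ge)
    exact this ▸ hu
  hom_inv_id := Hom.ext (funext fun c => R.satsIso.symm_apply_apply c)
  inv_hom_id := Hom.ext (funext fun c => R.satsIso.apply_symm_apply c)

end RaneyExt

/-- The canonical embeddings `R → (sats, opens)` of the Funayama envelopes form a natural
isomorphism. -/
noncomputable def raneyUnitIso : 𝟭 RaneyExt.{u} ≅ funayamaFunctor ⋙ raneyFunctor :=
  NatIso.ofComponents RaneyExt.envelopeIso fun f =>
    RaneyExt.Hom.ext (funext fun c => Subtype.ext (RaneyExt.Hom.lift_emb f c).symm)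

/-- The Funayama envelope is left adjoint to `raneyFunctor`: as `raneyFunctor` is fully faithful,
morphisms out of the envelope of `R` are morphisms out of its Raney extension, which the canonical
embedding identifies with `R`. -/
noncomputable def raneyAdj : funayamaFunctor.{u} ⊣ raneyFunctor.{u} :=
  Adjunction.mkOfHomEquiv
    { homEquiv := fun R _ =>
        raneyFunctorFullyFaithful.homEquiv.trans (raneyUnitIso.symm.app R).homFromEquiv
      homEquiv_naturality_left_symm := fun f g => by
        apply raneyFunctorFullyFaithful.map_injective
        have := raneyUnitIso.inv.naturality f
        simp only [Functor.comp_obj, Functor.comp_map, Functor.id_obj, Functor.id_map] at this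
        simp [Functor.FullyFaithful.homEquiv, ← reassoc_of% this]
      homEquiv_naturality_right := fun f g => by
        simp [Functor.FullyFaithful.homEquiv] }

theorem raneyAdj_unit_app (R : RaneyExt.{u}) : raneyAdj.unit.app R = R.envelopeIso.hom := by
  simp [raneyAdj, Functor.FullyFaithful.homEquiv, raneyUnitIso]

/-! ### `T₀`-algebras and the hull property of the Funayama envelope -/

namespace MTAlg

variable {M : MTAlg.{u}}

theorem mem_closeds_iff {a : M} : a ∈ M.closeds ↔ aᶜ ∈ M.opens := by
  change (M.box aᶜ)ᶜ = a ↔ M.box aᶜ = aᶜ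
  rw [compl_eq_comm, eq_comm]

theorem inf_closed_mem_BS {s c : M} (hs : s ∈ M.sats) (hc : c ∈ M.closeds) : s ⊓ c ∈ M.BS := by
  refine BooleanSubalgebra.inf_mem (M.sats_subset_BS hs) ?_
  rw [← compl_compl c]
  exact BooleanSubalgebra.compl_mem (M.opens_subset_BS (mem_closeds_iff.1 hc))

/-- In a `T₀`-algebra the elements of `BS M` are join-dense, because they include all `s ⊓ c`
with `s` saturated and `c` closed. -/
theorem IsT0.le_of_forall_BS (hM : MTAlg.IsT0 M) {a b : M} (h : ∀ x ∈ M.BS, x ≤ a → x ≤ b) :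
    a ≤ b := by
  obtain ⟨S, hS, rfl⟩ := hM a
  refine sSup_le fun x hx => ?_
  obtain ⟨s, hs, c, hc, rfl⟩ := hS x hx
  exact h _ (inf_closed_mem_BS hs hc) (le_sSup hx)

/-- In a `T₀`-algebra the elements of `BS M` are meet-dense: pass to complements. -/
theorem IsT0.le_of_forall_BS_ge (hM : MTAlg.IsT0 M) {a b : M} (h : ∀ x ∈ M.BS, b ≤ x → a ≤ x) :
    a ≤ b := by
  refine compl_le_compl_iff_le.1 (hM.le_of_forall_BS fun x hx hxb => ?_)
  exact le_compl_comm.1 (h xᶜ (BooleanSubalgebra.compl_mem hx) (le_compl_comm.1 hxb))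

end MTAlg

namespace RaneyExt

open DedekindCut

variable (R : RaneyExt.{u})

/-- An element of the boolean envelope is a finite join of differences `of a \ of b`. Since `b` is a
meet of elements of `L`, the complement of its image is a join of closed elements. -/
theorem principal_le_sSup_locallyClosed (x : BoolEnv R) : (principal x : R.funayama) ≤
    sSup {z | (∃ s ∈ R.funayama.sats, ∃ c ∈ R.funayama.closeds, z = s ⊓ c) ∧ z ≤ principal x} := by
  induction x using BoolEnv.induction_sdiff with
  | hsdiff a b =>
    obtain ⟨S, hS, rfl⟩ := R.exists_eq_sInf b
    have e : (principal (BoolEnv.of a \ BoolEnv.of (sInf S)) : R.funayama) =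
        ⨆ u ∈ S, R.emb a ⊓ (R.emb u)ᶜ := by
      rw [sdiff_eq, principal_inf, principal_compl]
      change R.emb a ⊓ (R.emb (sInf S))ᶜ = _
      rw [emb_sInf, sInf_image, compl_iInf]
      simp only [compl_iInf]
      exact inf_iSup₂_eq (α := R.funayama) (f := fun u (_ : u ∈ S) => (R.emb u)ᶜ) (R.emb a)
    conv_lhs => rw [e]
    refine iSup₂_le fun u hu => le_sSup ⟨⟨_, R.mem_sats_funayama.2 ⟨a, rfl⟩, _,
      MTAlg.mem_closeds_iff.2 ?_, rfl⟩, ?_⟩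
    · rw [compl_compl]
      exact R.mem_opens_funayama.2 ⟨u, hS hu, rfl⟩
    · rw [e]
      exact le_iSup₂ (f := fun u (_ : u ∈ S) => R.emb a ⊓ (R.emb u)ᶜ) u hu
  | hsup x y hx hy =>
    conv_lhs => rw [principal_sup]
    exact sup_le
      (hx.trans (sSup_le_sSup fun z hz =>
        ⟨hz.1, hz.2.trans (principal_le_principal.2 le_sup_left)⟩))
      (hy.trans (sSup_le_sSup fun z hz =>
        ⟨hz.1, hz.2.trans (principal_le_principal.2 le_sup_right)⟩))

theorem isT0_funayama : MTAlg.IsT0 R.funayama := fun a => by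
  refine ⟨{z | (∃ s ∈ R.funayama.sats, ∃ c ∈ R.funayama.closeds, z = s ⊓ c) ∧ z ≤ a},
    fun x hx => hx.1, le_antisymm ?_ (sSup_le fun x hx => hx.2)⟩
  refine le_of_forall_principal fun p hp => ?_
  exact (R.principal_le_sSup_locallyClosed p).trans
    (sSup_le_sSup fun z hz => ⟨hz.1, hz.2.trans hp⟩)

variable {R} {M : MTAlg.{u}}

theorem hom_inv_apply (i : raneyFunctor.obj M ≅ R) (s : M.sats) :
    i.inv.toFun (i.hom.toFun s) = s :=
  congrFun (congrArg Hom.toFun i.hom_inv_id) s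

theorem inv_hom_apply (i : raneyFunctor.obj M ≅ R) (c : R) :
    i.hom.toFun (i.inv.toFun c) = c :=
  congrFun (congrArg Hom.toFun i.inv_hom_id) c

/-- A `T₀`-algebra is the MacNeille completion of `BS M`, and `BS M` is the boolean envelope of the
saturated elements. -/
theorem exists_hullIso (hM : MTAlg.IsT0 M) (i : raneyFunctor.obj M ≅ R) :
    ∃ e : M ≃o R.funayama, ∀ s : M.sats, e s.1 = R.emb (i.hom.toFun s) := by
  let k : Hom R M.toRaneyExt := i.inv
  have hk : ∀ a b, k a ≤ k b → a ≤ b := fun a b h => by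
    have := OrderHomClass.mono (Hom.toBounded i.hom) h
    exact (inv_hom_apply i a).ge.trans (this.trans (inv_hom_apply i b).le)
  have hsurj : Function.Surjective k := fun s => ⟨i.hom.toFun s, hom_inv_apply i s⟩
  let γ : BoolEnv R ↪o M := OrderEmbedding.ofMapLEIff k.envHom fun _ _ => Hom.envHom_le_envHom hk
  let E : DedekindCut (BoolEnv R) ≃o M := isoOfDense γ
    (fun a b h => hM.le_of_forall_BS fun x hx => by
      obtain ⟨x, rfl⟩ := Hom.exists_envHom_eq hsurj hx
      exact h x)
    (fun a b h => hM.le_of_forall_BS_ge fun x hx => by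
      obtain ⟨x, rfl⟩ := Hom.exists_envHom_eq hsurj hx
      exact h x)
  refine ⟨E.symm, fun s => ?_⟩
  rw [OrderIso.symm_apply_eq]
  refine Eq.trans ?_ (isoOfDense_principal γ _ _ _).symm
  refine Eq.trans ?_ (Hom.envHom_of k _).symm
  exact congrArg Subtype.val (hom_inv_apply i s).symm

/-- An order isomorphism that induces an isomorphism of Raney extensions maps the open elements onto
the open elements, so it commutes with the interior operators. -/
theorem map_box_of_sats (e : M ≃o R.funayama) (i : raneyFunctor.obj M ≅ R)
    (he : ∀ s : M.sats, e s.1 = R.emb (i.hom.toFun s)) (a : M) :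
    e (M.box a) = R.funayama.box (e a) := by
  have hopen : ∀ b : M, M.box b ∈ M.opens := fun b => le_antisymm (M.box_le _) (M.le_box_box b)
  apply le_antisymm
  · let o : M.sats := ⟨M.box a, M.opens_subset_sats (hopen a)⟩
    refine le_sSup ⟨i.hom.toFun o, ⟨i.hom.map_mem o (hopen a), ?_⟩, (he o).symm⟩
    rw [← he o]
    exact e.monotone (M.box_le a)
  · refine sSup_le ?_
    rintro _ ⟨u, ⟨hu, hua⟩, rfl⟩
    have hu' : (i.inv.toFun u).1 ∈ M.opens := i.inv.map_mem u hu
    have eu : e (i.inv.toFun u).1 = R.emb u :=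
      (he (i.inv.toFun u)).trans (congrArg R.emb (inv_hom_apply i u))
    rw [← eu] at hua ⊢
    refine e.monotone ?_
    rw [← show M.box _ = _ from hu']
    exact M.box_mono (e.le_iff_le.1 hua)

/-- Order isomorphisms preserve complements and finite joins, so agreement on the saturated elements
spreads to `BS M`, which is join-dense in a `T₀`-algebra. -/
theorem orderIso_ext_sats (hM : MTAlg.IsT0 M) {e e' : M ≃o R.funayama}
    (h : ∀ s ∈ M.sats, e s = e' s) : e = e' := by
  have hBS : ∀ x ∈ M.BS, e x = e' x := fun x hx => by
    unfold MTAlg.BS at hx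
    induction hx using BooleanSubalgebra.closure_bot_sup_induction with
    | mem x hx => exact h x hx
    | bot => rw [map_bot, map_bot]
    | sup x hx y hy ihx ihy => rw [map_sup, map_sup, ihx, ihy]
    | compl x hx ih => rw [map_compl', map_compl', ih]
  have hle : ∀ {e e' : M ≃o R.funayama}, (∀ x ∈ M.BS, e x = e' x) → ∀ a, e a ≤ e' a := by
    intro e e' h a
    rw [← e.le_symm_apply]
    refine hM.le_of_forall_BS fun x hx hxa => ?_
    rw [e.le_symm_apply, h x hx]
    exact e'.monotone hxa
  exact OrderIso.ext (funext fun a =>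
    le_antisymm (hle hBS a) (hle (fun x hx => (hBS x hx).symm) a))

end RaneyExt

/-! ### The equivalences and the reflector -/

instance : IsIso raneyAdj.{u}.unit := by
  have : ∀ R, IsIso (raneyAdj.{u}.unit.app R) := fun R => by
    rw [raneyAdj_unit_app]; infer_instance
  exact NatIso.isIso_of_isIso_app _

instance : raneyFunctor.{u}.Full := raneyFunctorFullyFaithful.full

instance : raneyFunctor.{u}.Faithful := raneyFunctorFullyFaithful.faithful

instance : funayamaFunctor.{u}.Full := raneyAdj.fullyFaithfulLOfIsIsoUnit.full

instance : funayamaFunctor.{u}.Faithful := raneyAdj.fullyFaithfulLOfIsIsoUnit.faithful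

/-- The adjunction restricted to `T₀`-algebras, with the same unit and counit. -/
noncomputable def raneyAdjT0 :
    MTAlg.IsT0.lift funayamaFunctor.{u} RaneyExt.isT0_funayama ⊣ MTAlg.IsT0.ι ⋙ raneyFunctor.{u} :=
  Adjunction.mkOfUnitCounit
    { unit := { app := fun R => raneyAdj.unit.app R
                naturality := fun _ _ f => raneyAdj.unit.naturality f }
      counit :=
        { app := fun M => ObjectProperty.homMk (raneyAdj.counit.app M.obj)
          naturality := fun _ _ f => ObjectProperty.hom_ext _ (raneyAdj.counit.naturality f.hom) }
      left_triangle := by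
        ext R
        refine Eq.trans ?_ (raneyAdj.left_triangle_components R)
        exact congrArg (funayamaFunctor.map (raneyAdj.unit.app R) ≫ ·) (Category.id_comp _)
      right_triangle := by
        ext M
        exact (congrArg _ (Category.id_comp _)).trans (raneyAdj.right_triangle_components M.obj) }

/-- The reflection of MT-algebras onto `T₀`-algebras: as the counit is invertible, morphisms out of
`M` are morphisms out of the Funayama envelope of `(sats M, opens M)`. -/
noncomputable def t0Reflection :
    MTAlg.IsT0.lift (raneyFunctor.{u} ⋙ funayamaFunctor.{u})
      (fun M => RaneyExt.isT0_funayama (raneyFunctor.obj M)) ⊣ MTAlg.IsT0.ι :=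
  Adjunction.mkOfHomEquiv
    { homEquiv := fun M N => (MTAlg.IsT0.fullyFaithfulι.homEquiv).trans
        ((asIso (raneyAdj.counit.app M)).homFromEquiv)
      homEquiv_naturality_left_symm := fun f g => ObjectProperty.hom_ext _ (by
        simp only [Functor.FullyFaithful.homEquiv, Equiv.symm_trans_apply]
        exact (raneyAdj.counit.naturality_assoc f g).symm)
      homEquiv_naturality_right := fun f g => by
        simp [Functor.FullyFaithful.homEquiv] }

theorem t0Reflection_unit_app (M : MTAlg.{u}) :
    t0Reflection.unit.app M ≫ raneyAdj.counit.app M = 𝟙 M := by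
  simp only [t0Reflection, Adjunction.mkOfHomEquiv_unit_app, Functor.FullyFaithful.homEquiv]
  exact (congrArg (· ≫ _) (Category.comp_id _)).trans (IsIso.inv_hom_id _)

/-- The reflector is fully faithful as a composite of equivalences, and the invertible counit makes
it essentially surjective. -/
theorem isEquivalence_t0Reflector :
    (MTAlg.IsT0.lift (raneyFunctor.{u} ⋙ funayamaFunctor.{u})
      (fun M => RaneyExt.isT0_funayama (raneyFunctor.obj M))).IsEquivalence where
  faithful := Functor.Faithful.of_comp_iso (MTAlg.IsT0.liftCompιIso _ _)
  essSurj := ⟨fun M => ⟨M.obj, ⟨ObjectProperty.isoMk _ (asIso (raneyAdj.counit.app M.obj))⟩⟩⟩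
  full := Functor.Full.of_comp_faithful_iso (MTAlg.IsT0.liftCompιIso _ _)

theorem mainTheorem2 :
    ∃ (adj : funayamaFunctor.{u} ⊣ raneyFunctor.{u})
      (hT0 : ∀ R : RaneyExt.{u}, MTAlg.IsT0 (funayamaFunctor.obj R)),
      -- the adjoint equivalence of `RMT` and `Raney`; its unit is the canonical embedding
      (IsIso adj.unit ∧ IsIso adj.counit) ∧
      (∀ (R : RaneyExt.{u}) (c : R), ((adj.unit.app R).toFun c).1 = R.emb c) ∧
      -- it restricts to an adjoint equivalence of the `T₀`-algebras and `Raney`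
      (∃ adj0 : MTAlg.IsT0.lift funayamaFunctor.{u} hT0 ⊣ MTAlg.IsT0.ι ⋙ raneyFunctor.{u},
        (IsIso adj0.unit ∧ IsIso adj0.counit) ∧
        (∀ R : RaneyExt.{u}, adj0.unit.app R = adj.unit.app R) ∧
        (∀ M : MTAlg.IsT0.FullSubcategory,
          MTAlg.IsT0.ι.map (adj0.counit.app M) = adj.counit.app M.obj)) ∧
      -- the composite is a reflector onto the `T₀`-algebras, and it is an equivalence
      (∃ refl : MTAlg.IsT0.lift (raneyFunctor.{u} ⋙ funayamaFunctor.{u})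
          (fun M => hT0 (raneyFunctor.obj M)) ⊣ MTAlg.IsT0.ι,
        ∀ M : MTAlg.{u}, refl.unit.app M ≫ adj.counit.app M = 𝟙 M) ∧
      (MTAlg.IsT0.lift (raneyFunctor.{u} ⋙ funayamaFunctor.{u})
          (fun M => hT0 (raneyFunctor.obj M))).IsEquivalence ∧
      -- the Funayama envelope is the `T₀`-hull: the unique `T₀`-algebra whose Raney extension is `R`
      (∀ (R : RaneyExt.{u}) (M : MTAlg.{u}), MTAlg.IsT0 M →
        ∀ i : raneyFunctor.obj M ≅ R,
          ∃! e : M ≃o R.funayama, (∀ a, e (M.box a) = R.funayama.box (e a)) ∧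
            ∀ s : M.sats, e s.1 = R.emb (i.hom.toFun s)) := by
  refine ⟨raneyAdj, RaneyExt.isT0_funayama, ⟨inferInstance, inferInstance⟩, fun R c => ?_,
    ⟨raneyAdjT0, ⟨?_, ?_⟩, fun _ => rfl, fun _ => rfl⟩,
    ⟨t0Reflection, t0Reflection_unit_app⟩, isEquivalence_t0Reflector, fun R M hM i => ?_⟩
  · rw [raneyAdj_unit_app]
    rfl
  · have : ∀ R, IsIso (raneyAdjT0.{u}.unit.app R) := fun R =>
      inferInstanceAs (IsIso (raneyAdj.unit.app R))
    exact NatIso.isIso_of_isIso_app _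
  · have : ∀ M, IsIso (raneyAdjT0.{u}.counit.app M) := fun M =>
      (MTAlg.IsT0.isIso_hom_iff _).1 (inferInstanceAs (IsIso (raneyAdj.counit.app M.obj)))
    exact NatIso.isIso_of_isIso_app _
  · obtain ⟨e, he⟩ := RaneyExt.exists_hullIso hM i
    refine ⟨e, ⟨RaneyExt.map_box_of_sats e i he, he⟩, fun e' he' => ?_⟩
    exact RaneyExt.orderIso_ext_sats hM fun s hs => (he'.2 ⟨s, hs⟩).trans (he ⟨s, hs⟩).symm
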